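/- Let $\mathbf k$ be a field, $R=\mathbf k[x_1,\dots,x_n]$, $\mathfrak m=(x_1,\dots,x_n)$, and let $I=(f_0,\dots,f_n)\subset R$ be a perfect ideal of codimension $2$ generated by $n+1$ forms of the same degree, with presentation $R^n\xrightarrow{\varphi}R^{n+1}\to I\to 0$, where the entries of the $j$-th column of $\varphi$ are forms of the same degree $d_j\ge 1$. Assume $\mu(I_p)\le\dim R_p$ for every prime $p\supseteq I$, $p\ne\mathfrak m$, where $\mu$ is the minimal number of generators. Put $S=\mathbf k[T_0,\dots,T_n]$, $B=R[T_0,\dots,T_n]=S[x_1,\dots,x_n]$, $[l_1,\dots,l_n]=[T_0,\dots,T_n]\,\varphi$ and $\delta=d_1+\dots+d_n-n$. View $\mathrm{Sym}_R(I)=B/(l_1,\dots,l_n)$, and for an integer $e$ let $\mathrm{Sym}(I)_e$ be the $S$-module of its elements of degree $e$ in $x_1,\dots,x_n$. Fix an integer $i$, and let $$0\to F_n\xrightarrow{\alpha_n}\cdots\to F_1\xrightarrow{\alpha_1}F_0$$ be the part of degree $\delta-i$ (in $x_1,\dots,x_n$) of the Koszul complex of $l_1,\dots,l_n$ over $B$;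 it is a complex of finite free $S$-modules resolving $\mathrm{Sym}(I)_{\delta-i}$ (some of the $F_t$ may be $0$). Let $f_t=\operatorname{rk}F_t$, $r_t=\operatorname{rk}\alpha_t$, fix orientations $\eta_t:\wedge^{f_t}F_t\cong S$, and let $a_t\in\wedge^{r_t}F_{t-1}$ ($1\le t\le n$) be the Buchsbaum–Eisenbud multipliers of this complex: $a_n=(\wedge^{r_n}\alpha_n)(\eta_n^{-1}(1))$ and, for $1\le t<n$, $(\wedge^{r_t}\alpha_t)(w)=\eta_t(a_{t+1}\wedge w)\,a_t$ for all $w\in\wedge^{r_t}F_t$. Consider the maps $$\wedge^{f_0-r_1-1}F_0\otimes S(-s_1)\xrightarrow{\ \partial\ }F_0^*\xrightarrow{\ \alpha_1^*\ }F_1^*,\qquad \partial(u\otimes 1)=\big(v\mapsto\eta_0(v\wedge u\wedge a_1)\big),$$ where the twist by $s_1=\sum_{t\ge1}(-1)^{t-1}r_t$ only records the degree of $a_1$. Suppose $\operatorname{rank}_S\mathrm{Sym}(I)_{\delta-i}=1$, so that $\wedge^{f_0-r_1-1}F_0\otimes S(-s_1)=S(-s_1)$. Then this is a complex, i.e. $\alpha_1^*\circ\partial=0$,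 and it is exact (at $F_0^*$) if and only if $\operatorname{grade}I(a_1)\ge 2$, where $I(a_1)$ is the ideal of $S$ generated by the coordinates of $a_1$ and the unit ideal has grade $\infty$. -/

import Mathlib

open MvPolynomial

universe u

noncomputable section

/-- The grade of an ideal `I`: the supremum of the lengths of the sequences of elements of `I` that
are regular on the ring `A`. For a proper ideal of a Noetherian ring weakly regular sequences in `I`
are the regular sequences in `I`; the unit ideal gets grade `⊤`. -/
def Ideal.seqGrade {A : Type*} [CommRing A] (I : Ideal A) : ℕ∞ :=
  ⨆ rs : {rs : List A // (∀ a ∈ rs, a ∈ I) ∧ RingTheory.Sequence.IsWeaklyRegular A rs},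
    (rs.1.length : ℕ∞)

/-- An ideal `I` of a Noetherian ring `A` is perfect if `grade I = pd (A / I)`. -/
def Ideal.IsPerfectIdeal {A : Type u} [CommRing A] (I : Ideal A) : Prop :=
  ((I.seqGrade : ℕ∞) : WithBot ℕ∞) =
    CategoryTheory.projectiveDimension (ModuleCat.of A (A ⧸ I))

section FreeModules

variable {A : Type*} [CommRing A] {F G : Type*} [AddCommGroup F] [Module A F]
  [AddCommGroup G] [Module A G]

/-- The rank of a map of finite free modules over a domain. -/
def LinearMap.mapRank (φ : F →ₗ[A] G) : ℕ := Module.finrank A (LinearMap.range φ)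

/-- `I_t(φ)`, the ideal generated by the entries of `⋀^t φ` (the `t × t` minors of `φ`). -/
def LinearMap.minorsIdeal (t : ℕ) (φ : F →ₗ[A] G) : Ideal A :=
  Ideal.span {c | ∃ (w : ⋀[A]^t F) (ψ : Module.Dual A (⋀[A]^t G)), c = ψ (exteriorPower.map t φ w)}

/-- `I(φ) = I_r(φ)` where `r` is the rank of `φ`. -/
def LinearMap.rankIdeal (φ : F →ₗ[A] G) : Ideal A := φ.minorsIdeal φ.mapRank

variable (A F) in
/-- An orientation of a finite free module `F` of rank `f`: an isomorphism `⋀^f F ≅ A`. -/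
abbrev FreeOrientation : Type _ := (⋀[A]^(Module.finrank A F) F) ≃ₗ[A] A

/-- An orientation, extended by zero to a linear form on the whole exterior algebra
(first project to the top exterior power, then apply the orientation). -/
def FreeOrientation.form (η : FreeOrientation A F) : ExteriorAlgebra A F →ₗ[A] A :=
  η.toLinearMap ∘ₗ DirectSum.component A ℕ (fun t => ⋀[A]^t F) (Module.finrank A F) ∘ₗ
    (DirectSum.decomposeLinearEquiv (fun t : ℕ => ⋀[A]^t F)).toLinearMap

/-- For `x ∈ ⋀ F`, the linear form `v ↦ η (v ∧ x)` on `F`. On `⋀^(f-1) F` this is the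
isomorphism `⋀^(f-1) F ≅ F^*` given by the orientation `η`. -/
def FreeOrientation.toDual (η : FreeOrientation A F) :
    ExteriorAlgebra A F →ₗ[A] Module.Dual A F :=
  ((LinearMap.mul A (ExteriorAlgebra A F)).compr₂ η.form ∘ₗ ExteriorAlgebra.ι A).flip

end FreeModules

/-- Let `R = 𝕜[x_1, …, x_n]`. A homogeneous `R`-ideal `I = (f_0, …, f_n)`, perfect of codimension two,
generated by `n + 1` forms of the same degree, with a graded presentation matrix `φ` whose `j`-th
column consists of forms of positive degree `d_j`, and such that `μ(I_p) ≤ dim R_p` for all primes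
`p` in the support of `R / I` other than the homogeneous maximal ideal. -/
structure CodimTwoSetup (𝕜 : Type u) [Field 𝕜] (n : ℕ) where
  /-- the generators of `I` -/
  f : Fin (n + 1) → MvPolynomial (Fin n) 𝕜
  /-- the presentation matrix -/
  φ : Matrix (Fin (n + 1)) (Fin n) (MvPolynomial (Fin n) 𝕜)
  /-- the degree of the generators -/
  deg : ℕ
  /-- the column degrees of `φ` -/
  d : Fin n → ℕ
  f_homogeneous : ∀ i, (f i).IsHomogeneous deg
  φ_homogeneous : ∀ i j, (φ i j).IsHomogeneous (d j)
  d_pos : ∀ j, 0 < d j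
  presentation : Function.Exact φ.mulVecLin
    (Fintype.linearCombination (MvPolynomial (Fin n) 𝕜) f)
  codim_two : (Ideal.span (Set.range f)).height = 2
  perfect : (Ideal.span (Set.range f)).IsPerfectIdeal
  local_generators : ∀ (p : Ideal (MvPolynomial (Fin n) 𝕜)) [p.IsPrime],
    Ideal.span (Set.range f) ≤ p → p ≠ Ideal.span (Set.range X) →
      ((Submodule.spanFinrank ((Ideal.span (Set.range f)).map
          (algebraMap (MvPolynomial (Fin n) 𝕜) (Localization.AtPrime p))) : ℕ∞) : WithBot ℕ∞) ≤
        ringKrullDim (Localization.AtPrime p)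

namespace CodimTwoSetup

variable {𝕜 : Type u} [Field 𝕜] {n : ℕ} (D : CodimTwoSetup 𝕜 n)

/-- The ideal `I`. -/
def I : Ideal (MvPolynomial (Fin n) 𝕜) := Ideal.span (Set.range D.f)

/-- `δ = d_1 + ⋯ + d_n - n`. -/
def δ : ℤ := ∑ j, (D.d j : ℤ) - n

variable (𝕜 n) in
/-- `S = 𝕜[T_0, …, T_n]`. -/
abbrev S : Type u := MvPolynomial (Fin (n + 1)) 𝕜

variable (𝕜 n) in
/-- `B = R[T_0, …, T_n] = S[x_1, …, x_n]`. -/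
abbrev B : Type u := MvPolynomial (Fin n) (S 𝕜 n)

variable (𝕜 n) in
/-- `B_e`: the `S`-module of the elements of `B` that are homogeneous of degree `e ∈ ℤ` in
`x_1, …, x_n` (zero if `e < 0`). -/
def piece (e : ℤ) : Submodule (S 𝕜 n) (B 𝕜 n) :=
  weightedHomogeneousSubmodule (S 𝕜 n) (fun _ : Fin n => (1 : ℤ)) e

/-! ### The symmetric algebra of `I` -/

/-- `Sym_R(I)`. -/
def Sym : Type u := SymmetricAlgebra (MvPolynomial (Fin n) 𝕜) D.I

instance : CommRing D.Sym :=
  inferInstanceAs (CommRing (SymmetricAlgebra (MvPolynomial (Fin n) 𝕜) D.I))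

instance : Algebra (MvPolynomial (Fin n) 𝕜) D.Sym :=
  inferInstanceAs (Algebra (MvPolynomial (Fin n) 𝕜)
    (SymmetricAlgebra (MvPolynomial (Fin n) 𝕜) D.I))

/-- The degree one element of `Sym_R(I)` given by the generator `f_i` of `I`. -/
def symGen (i : Fin (n + 1)) : D.Sym :=
  SymmetricAlgebra.ι (MvPolynomial (Fin n) 𝕜) D.I
    ⟨D.f i, Ideal.subset_span (Set.mem_range_self i)⟩

/-- `Sym_R(I)` is an `S`-algebra, where `T_i` acts as the generator `f_i` in degree one. -/
instance : Algebra (S 𝕜 n) D.Sym :=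
  (eval₂Hom ((algebraMap (MvPolynomial (Fin n) 𝕜) D.Sym).comp C) D.symGen).toAlgebra

/-- The surjection `π' : B → Sym_R(I)`, `x_i ↦ x_i`, `T_i ↦ f_i`. -/
def symMap : B 𝕜 n →ₐ[S 𝕜 n] D.Sym :=
  aeval fun i => algebraMap (MvPolynomial (Fin n) 𝕜) D.Sym (X i)

/-- The `S`-module `Sym(I)_e = [Sym_R(I)]_(e,*)`, the component of degree `e` in `x_1, …, x_n` for the
bigrading of `Sym_R(I)` as a quotient of `B`. -/
def symPiece (e : ℤ) : Submodule (S 𝕜 n) D.Sym :=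
  (piece 𝕜 n e).map D.symMap.toLinearMap

/-! ### The graded strands of the Koszul complex -/

/-- The entries of `[l_1, …, l_n] = [T_0, …, T_n] φ`. -/
def l (j : Fin n) : B 𝕜 n := ∑ i, C (X i) * map C (D.φ i j)

lemma l_mem (j : Fin n) : D.l j ∈ piece 𝕜 n (D.d j) := by
  refine Submodule.sum_mem _ fun i _ => ?_
  rw [← smul_eq_C_mul]
  refine Submodule.smul_mem _ _ ?_
  intro m hm
  rw [coeff_map] at hm
  have hm' : coeff m (D.φ i j) ≠ 0 := fun h => hm (by rw [h, map_zero])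
  have h := D.φ_homogeneous i j hm'
  rw [← h]
  simp [Finsupp.weight_apply, Finsupp.sum]

lemma l_mul_mem (j : Fin n) {e e' : ℤ} (h : e' = e + D.d j) {p : B 𝕜 n} (hp : p ∈ piece 𝕜 n e) :
    D.l j * p ∈ piece 𝕜 n e' := by
  subst h
  exact add_comm (D.d j : ℤ) e ▸ IsWeightedHomogeneous.mul (D.l_mem j) hp

/-- Multiplication by `l_j` as an `S`-linear map `B_e → B_e'` where `e' = e + d_j`. -/
def mulL (j : Fin n) (e e' : ℤ) (h : e' = e + D.d j) : piece 𝕜 n e →ₗ[S 𝕜 n] piece 𝕜 n e' :=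
  (LinearMap.mulLeft (S 𝕜 n) (D.l j)).restrict fun _ hp => D.l_mul_mem j h hp

/-- `F_t`, the term of homological degree `t` in the strand of degree `e` (with respect to
`x_1, …, x_n`) of the Koszul complex of `l_1, …, l_n` over `B`: the direct sum of the modules
`B_(e - ∑_{j ∈ J} d_j)` over all `t`-element subsets `J` of `{1, …, n}`. -/
def F (e : ℤ) (t : ℕ) : Type u :=
  (J : {J : Finset (Fin n) // J.card = t}) → piece 𝕜 n (e - ∑ j ∈ J.1, (D.d j : ℤ))

instance (e : ℤ) (t : ℕ) : AddCommGroup (D.F e t) :=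
  inferInstanceAs (AddCommGroup ((J : {J : Finset (Fin n) // J.card = t}) →
    piece 𝕜 n (e - ∑ j ∈ J.1, (D.d j : ℤ))))

instance (e : ℤ) (t : ℕ) : Module (S 𝕜 n) (D.F e t) :=
  inferInstanceAs (Module (S 𝕜 n) ((J : {J : Finset (Fin n) // J.card = t}) →
    piece 𝕜 n (e - ∑ j ∈ J.1, (D.d j : ℤ))))

/-- The component of `F_t` belonging to the subset `J`. -/
def proj (e : ℤ) (t : ℕ) (J : {J : Finset (Fin n) // J.card = t}) :
    D.F e t →ₗ[S 𝕜 n] piece 𝕜 n (e - ∑ j ∈ J.1, (D.d j : ℤ)) where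
  toFun g := g J
  map_add' _ _ := rfl
  map_smul' _ _ := rfl

lemma insert_degree (J : Finset (Fin n)) (j : Fin n) (hj : j ∉ J) (e : ℤ) :
    e - ∑ i ∈ J, (D.d i : ℤ) = e - ∑ i ∈ insert j J, (D.d i : ℤ) + D.d j := by
  rw [Finset.sum_insert hj]; ring

/-- The component of the Koszul differential `F_{t+1} → F_t` belonging to a `t`-element subset `J`:
`g ↦ ∑_{j ∉ J} (-1)^{#{i ∈ J : i < j}} l_j g(J ∪ {j})`. -/
def αComponent (e : ℤ) (t : ℕ) (J : {J : Finset (Fin n) // J.card = t}) :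
    D.F e (t + 1) →ₗ[S 𝕜 n] piece 𝕜 n (e - ∑ j ∈ J.1, (D.d j : ℤ)) :=
  ∑ j : {j : Fin n // j ∉ J.1},
    ((-1 : S 𝕜 n) ^ (J.1.filter (· < j.1)).card) •
      (D.mulL j.1 _ _ (D.insert_degree J.1 j.1 j.2 e) ∘ₗ
        D.proj e (t + 1) ⟨insert j.1 J.1, by rw [Finset.card_insert_of_notMem j.2, J.2]⟩)

/-- The Koszul differential `α_{t+1} : F_{t+1} → F_t`. It maps the basis vector of
`J = {j_0 < ⋯ < j_t}` to the sum over `s` of `(-1)^s l_{j_s}` times the basis vector of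
`J \ {j_s}`. -/
def α (e : ℤ) (t : ℕ) : D.F e (t + 1) →ₗ[S 𝕜 n] D.F e t where
  toFun g := fun J => D.αComponent e t J g
  map_add' g h := funext fun J => map_add (D.αComponent e t J) g h
  map_smul' c g := funext fun J => map_smul (D.αComponent e t J) c g

/-- The rank `r_{t+1}` of `α_{t+1}`. -/
def r (e : ℤ) (t : ℕ) : ℕ := (D.α e t).mapRank

/-! ### Buchsbaum–Eisenbud multipliers -/

/-- `a t ∈ ⋀^{r_{t+1}} F_t` (the image of `1` under the map `a_{t+1}`) are the Buchsbaum–Eisenbud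
multipliers of `0 → F_n → ⋯ → F_1 → F_0` with respect to the orientations `η`:
`a_n = ⋀^{r_n} α_n : S ≅ ⋀^{r_n} F_n → ⋀^{r_n} F_{n-1}`, and `⋀^{r_k} α_k = a_k ∘ a_{k+1}^*` for
`1 ≤ k < n`, where `a_{k+1}^* : ⋀^{r_k} F_k ≅ (⋀^{r_{k+1}} F_k)^* → S` is `w ↦ η (a_{k+1} ∧ w)`.
Leading modules `F_t` that are zero do not affect the multipliers of the remaining complex. -/
structure IsMultipliers (e : ℤ) (η : ∀ t, FreeOrientation (S 𝕜 n) (D.F e t))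
    (a : ∀ t, ⋀[S 𝕜 n]^(D.r e t) (D.F e t)) : Prop where
  last : ∀ t, t + 1 = n →
    (a t : ExteriorAlgebra (S 𝕜 n) (D.F e t)) =
      ExteriorAlgebra.map (D.α e t) ((η (t + 1)).symm 1 : ⋀[S 𝕜 n]^_ (D.F e (t + 1)))
  factor : ∀ t, t + 1 < n → ∀ w : ⋀[S 𝕜 n]^(D.r e t) (D.F e (t + 1)),
    exteriorPower.map (D.r e t) (D.α e t) w =
      (η (t + 1)).form ((a (t + 1) : ExteriorAlgebra (S 𝕜 n) (D.F e (t + 1))) * w) • a t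

/-- The map `⋀^{f_0 - r_1 - 1} F_0 → F_0^*`, `u ↦ η (u ∧ a_1)`, where `⋀^{f_0 - 1} F_0` is identified
with `F_0^*` by the orientation `η` of `F_0`. -/
def dualMap (e : ℤ) (η : FreeOrientation (S 𝕜 n) (D.F e 0))
    (a₁ : ⋀[S 𝕜 n]^(D.r e 0) (D.F e 0)) :
    ⋀[S 𝕜 n]^(Module.finrank (S 𝕜 n) (D.F e 0) - D.r e 0 - 1) (D.F e 0) →ₗ[S 𝕜 n]
      Module.Dual (S 𝕜 n) (D.F e 0) :=
  η.toDual ∘ₗ LinearMap.mulRight (S 𝕜 n) (a₁ : ExteriorAlgebra (S 𝕜 n) (D.F e 0)) ∘ₗ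
    Submodule.subtype _

end CodimTwoSetup

end

/-! Since `Sym(I)_{δ-i}` is the cokernel of `α_1`, rank one means `f_0 = r_1 + 1`, so wedging with
`a_1` gives a single linear form `D = η_0(- ∧ a_1)` on `F_0`, and the image of `∂` is `S · D`. Pick
`w_1, …, w_r` (`r = r_1`) with independent images under `α_1`. The multiplier factorization gives
`α_1 w_1 ∧ ⋯ ∧ α_1 w_r = c a_1`, so `c D` is the form `v ↦ η_0(v ∧ α_1 w_1 ∧ ⋯ ∧ α_1 w_r)`. It is
nonzero and vanishes on the image of `α_1`; hence so does `D`. As `ker α_1^*` has rank one, it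
consists of all forms proportional to `D` over the fraction field, and exactness says that each of
them is an `S`-multiple of `D`. The pairing of `F_0` with `⋀^r F_0` is perfect, so `I(a_1)` is the
ideal of values of `D`. Over the factorial ring `S` this ideal has grade at least two exactly when
no prime element divides `D`, that is, when every form proportional to `D` is a multiple of it. The
general argument is `toDual_exact_iff`, resting on `FreeOrientation.exists_toDual_apply_eq` and
`two_le_seqGrade_range_iff`; `ker_augmentation` supplies the rank count. -/

noncomputable section

/-! ### Orientations as volume forms. -/

namespace FreeOrientation

variable {A F : Type*} [CommRing A] [AddCommGroup F] [Module A F] (η : FreeOrientation A F)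

lemma form_coe (x : ⋀[A]^(Module.finrank A F) F) : η.form (x : ExteriorAlgebra A F) = η x := by
  simp only [form, LinearMap.comp_apply, LinearEquiv.coe_coe, DirectSum.component,
    DirectSum.decomposeLinearEquiv_apply]
  congr 1
  exact Subtype.ext (DirectSum.decompose_of_mem_same _ x.2)

lemma toDual_apply (x : ExteriorAlgebra A F) (v : F) :
    η.toDual x v = η.form (ExteriorAlgebra.ι A v * x) := rfl

/-- The alternating form `(v_1, …, v_f) ↦ η (v_1 ∧ ⋯ ∧ v_f)`. -/
def alternating (f : ℕ) : F [⋀^Fin f]→ₗ[A] A :=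
  η.form.compAlternatingMap (ExteriorAlgebra.ιMulti A f)

lemma toDual_ιMulti {r : ℕ} (w : Fin r → F) (v : F) :
    η.toDual (ExteriorAlgebra.ιMulti A r w) v = η.alternating (r + 1) (Fin.cons v w) := by
  simp only [toDual_apply, alternating, LinearMap.compAlternatingMap_apply]
  rw [ExteriorAlgebra.ιMulti_succ_apply]
  rfl

/-- An alternating form in top degree is its value on `b` times `b.det`. Evaluating at `η.symm 1`
exhibits 1 as a multiple of that value. -/
lemma isUnit_alternating_basis {f : ℕ} (hf : Module.finrank A F = f)
    (b : Module.Basis (Fin f) A F) : IsUnit (η.alternating f b) := by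
  subst hf
  have key : (η : ⋀[A]^(Module.finrank A F) F →ₗ[A] A) =
      η.alternating _ b • exteriorPower.alternatingMapLinearEquiv b.det := by
    apply exteriorPower.linearMap_ext
    ext v
    have h := congrArg (fun g => g v) ((η.alternating _).eq_smul_basis_det b)
    simp only [LinearMap.compAlternatingMap_apply, LinearEquiv.coe_coe, LinearMap.smul_apply,
      exteriorPower.alternatingMapLinearEquiv_apply_ιMulti, ← form_coe]
    simpa [alternating] using h
  have h1 := congrArg (fun g => g (η.symm 1)) key
  simp only [LinearEquiv.coe_coe, LinearEquiv.apply_symm_apply, LinearMap.smul_apply,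
    smul_eq_mul] at h1
  exact IsUnit.of_mul_eq_one _ h1.symm

lemma alternating_ne_zero [IsDomain A] {f : ℕ} (hf : Module.finrank A F = f)
    (b : Module.Basis (Fin f) A F) {v : Fin f → F} (hv : LinearIndependent A v) :
    η.alternating f v ≠ 0 := by
  rw [(η.alternating f).eq_smul_basis_det b, AlternatingMap.smul_apply, smul_eq_mul]
  refine mul_ne_zero (η.isUnit_alternating_basis hf b).ne_zero ?_
  rw [b.det_apply]
  intro h
  -- Over a domain a vanishing determinant yields a nonzero kernel vector, which is a linear
  -- relation among the `v i`.
  obtain ⟨c, hc, h⟩ := Matrix.exists_mulVec_eq_zero_iff.mpr h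
  apply hc
  funext i
  refine Fintype.linearIndependent_iff.mp hv c ?_ i
  apply b.repr.injective
  ext j
  have := congrFun h j
  simpa [Matrix.mulVec, dotProduct, b.toMatrix_apply, mul_comm] using this

end FreeOrientation

open FreeOrientation

/-! ### The perfect pairing, grade two, and maps of corank one. -/

section

variable {A F : Type*} [CommRing A] [AddCommGroup F] [Module A F]

/-- An increasing embedding is determined by its range, whose complement here is one point `j`. This
lets the basis of `⋀^r F` be indexed by the omitted basis vector. -/
lemma exists_succAbove_eq {r : ℕ} (e : Fin r ↪o Fin (r + 1)) :
    ∃ j : Fin (r + 1), ⇑e = j.succAbove := by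
  have hc : ((Finset.univ.map e.toEmbedding)ᶜ).card = 1 := by
    rw [Finset.card_compl]; simp
  obtain ⟨j, hj⟩ := Finset.card_eq_one.mp hc
  refine ⟨j, ?_⟩
  have : e = Fin.succAboveOrderEmb j := by
    rw [← OrderEmbedding.range_inj]
    ext k
    have := Finset.ext_iff.mp hj k
    simp only [Finset.mem_compl, Finset.mem_map, Finset.mem_univ, true_and,
      Finset.mem_singleton, RelEmbedding.coe_toEmbedding] at this
    simp only [Set.mem_range, Fin.succAboveOrderEmb_apply]
    rw [← Set.mem_range (f := j.succAbove), Fin.range_succAbove]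
    simp only [Set.mem_compl_iff, Set.mem_singleton_iff]
    tauto
  rw [this]; rfl

/-- The exterior product pairing `F × ⋀^r F → A` given by an orientation represents every linear
form on `⋀^r F`, if `F` has rank `r + 1`. -/
lemma FreeOrientation.exists_toDual_apply_eq [Nontrivial A] [Module.Free A F] [Module.Finite A F]
    (η : FreeOrientation A F) {r : ℕ} (hF : Module.finrank A F = r + 1)
    (ψ : Module.Dual A (⋀[A]^r F)) :
    ∃ v : F, ∀ x : ⋀[A]^r F, η.toDual (x : ExteriorAlgebra A F) v = ψ x := by
  let b : Module.Basis (Fin (r + 1)) A F := Module.finBasisOfFinrankEq A F hF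
  let m (j : Fin (r + 1)) : ⋀[A]^r F := exteriorPower.ιMulti A r (b ∘ j.succAbove)
  -- `b j ∧ m j` is the wedge of a permuted basis, while for `k ≠ j` the wedge `b k ∧ m j` repeats a
  -- factor. The pairing matrix is thus diagonal with unit entries.
  have hdiag (j) : IsUnit (η.toDual (m j : ExteriorAlgebra A F) (b j)) := by
    have h : Function.Bijective (Fin.cons j j.succAbove : Fin (r + 1) → Fin (r + 1)) := by
      rw [Finite.injective_iff_bijective.symm, Fin.cons_injective_iff]
      refine ⟨?_, Fin.succAbove_right_injective⟩
      rintro ⟨i, hi⟩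
      exact Fin.succAbove_ne j i hi
    have e : (Fin.cons (b j) (b ∘ j.succAbove) : Fin (r + 1) → F) =
        b.reindex (Equiv.ofBijective _ h).symm := by
      ext k
      rw [Module.Basis.reindex_apply, Equiv.symm_symm, Equiv.ofBijective_apply]
      refine Fin.cases ?_ (fun k => ?_) k <;> simp
    simp only [m, exteriorPower.ιMulti_apply_coe]
    rw [toDual_ιMulti, e]
    exact η.isUnit_alternating_basis hF _
  have hoff (j k) (h : k ≠ j) : η.toDual (m j : ExteriorAlgebra A F) (b k) = 0 := by
    obtain ⟨i, rfl⟩ := Fin.exists_succAbove_eq h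
    simp only [m, exteriorPower.ιMulti_apply_coe]
    rw [toDual_ιMulti]
    exact (η.alternating _).map_eq_zero_of_eq _ (i := 0) (j := i.succ) (by simp)
      (Fin.succ_ne_zero i).symm
  refine ⟨∑ j, (ψ (m j) * ((hdiag j).unit⁻¹ : Aˣ)) • b j, ?_⟩
  suffices η.toDual.flip (∑ j, (ψ (m j) * ((hdiag j).unit⁻¹ : Aˣ)) • b j) ∘ₗ
      Submodule.subtype (⋀[A]^r F) = ψ from fun x => LinearMap.congr_fun this x
  apply LinearMap.ext_on (exteriorPower.ιMulti_family_span_of_span A b.span_eq)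
  rintro x ⟨s, rfl⟩
  obtain ⟨j, hj⟩ := exists_succAbove_eq (Set.powersetCard.ofFinEmbEquiv.symm s)
  have hm : exteriorPower.ιMulti_family A r b s = m j := by
    simp only [exteriorPower.ιMulti_family, m, hj]
  rw [hm, LinearMap.comp_apply, Submodule.subtype_apply, LinearMap.flip_apply, map_sum,
    Finset.sum_eq_single j (fun k _ hk => by rw [map_smul, hoff j k hk, smul_zero]) (by simp),
    map_smul, smul_eq_mul, mul_assoc]
  simp

lemma mapRank_toSpanSingleton [IsDomain A] [Module.IsTorsionFree A F] {a : F} (ha : a ≠ 0) :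
    (LinearMap.toSpanSingleton A F a).mapRank = 1 := by
  rw [LinearMap.mapRank, LinearMap.finrank_range_of_inj, Module.finrank_self]
  exact LinearMap.ker_eq_bot.mp (LinearMap.ker_toSpanSingleton A ha)

lemma minorsIdeal_one_toSpanSingleton (a : F) :
    (LinearMap.toSpanSingleton A F a).minorsIdeal 1 =
      Ideal.span (Set.range fun ψ : Module.Dual A F => ψ a) := by
  have h (w) := LinearMap.congr_fun
    (exteriorPower.oneEquiv_naturality (LinearMap.toSpanSingleton A F a)) w
  simp only [LinearMap.comp_apply, LinearEquiv.coe_coe, LinearMap.toSpanSingleton_apply] at h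
  apply le_antisymm
  · rw [LinearMap.minorsIdeal, Ideal.span_le]
    rintro _ ⟨w, ψ, rfl⟩
    rw [← (exteriorPower.oneEquiv A F).symm_apply_apply
      (exteriorPower.map 1 (LinearMap.toSpanSingleton A F a) w), h, map_smul, map_smul]
    exact Ideal.mul_mem_left _ _ (Ideal.subset_span
      ⟨ψ ∘ₗ (exteriorPower.oneEquiv A F).symm.toLinearMap, rfl⟩)
  · rw [Ideal.span_le]
    rintro _ ⟨ψ, rfl⟩
    refine Ideal.subset_span ⟨(exteriorPower.oneEquiv A A).symm 1,
      ψ ∘ₗ (exteriorPower.oneEquiv A F).toLinearMap, ?_⟩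
    simp [h]

/-- The first two terms of a longer weakly regular sequence already form one, and regularity of `y`
modulo `x` is a divisibility condition. -/
lemma Ideal.two_le_seqGrade_iff (J : Ideal A) :
    2 ≤ J.seqGrade ↔ ∃ x ∈ J, ∃ y ∈ J, IsSMulRegular A x ∧ ∀ q, x ∣ y * q → x ∣ q := by
  have hcons (x y : A) (l : List A) : RingTheory.Sequence.IsWeaklyRegular A (x :: y :: l) ↔
      (IsSMulRegular A x ∧ ∀ q, x ∣ y * q → x ∣ q) ∧
        RingTheory.Sequence.IsWeaklyRegular (QuotSMulTop y (QuotSMulTop x A)) l := by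
    rw [RingTheory.Sequence.isWeaklyRegular_cons_iff,
      RingTheory.Sequence.isWeaklyRegular_cons_iff, and_assoc]
    refine and_congr_right fun _ => and_congr_left fun _ => ?_
    rw [isSMulRegular_iff_right_eq_zero_of_smul]
    have hm (q : A) : (Submodule.Quotient.mk q : QuotSMulTop x A) = 0 ↔ x ∣ q := by
      rw [Submodule.Quotient.mk_eq_zero, Submodule.mem_smul_pointwise_iff_exists]
      simp [dvd_def, eq_comm]
    constructor
    · intro h q hq
      rw [← hm]
      apply h
      rwa [← Submodule.Quotient.mk_smul, hm]
    · intro h q hq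
      obtain ⟨q, rfl⟩ := Submodule.Quotient.mk_surjective _ q
      rw [← Submodule.Quotient.mk_smul, hm] at hq
      exact (hm q).mpr (h q hq)
  constructor
  · intro h
    obtain ⟨⟨rs, hJ, hr⟩, hl⟩ : ∃ rs : {rs : List A // (∀ a ∈ rs, a ∈ J) ∧
        RingTheory.Sequence.IsWeaklyRegular A rs}, 2 ≤ rs.1.length := by
      by_contra! hlt
      have : J.seqGrade ≤ 1 := iSup_le fun rs => by
        exact_mod_cast Nat.lt_succ_iff.mp (hlt rs)
      exact absurd (h.trans this) (by decide)
    obtain _ | ⟨x, _ | ⟨y, l⟩⟩ := rs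
    · simp at hl
    · simp at hl
    · exact ⟨x, hJ x (by simp), y, hJ y (by simp), ((hcons x y l).mp hr).1⟩
  · rintro ⟨x, hx, y, hy, h⟩
    refine le_iSup_of_le (f := fun rs : {rs : List A // (∀ a ∈ rs, a ∈ J) ∧
        RingTheory.Sequence.IsWeaklyRegular A rs} => (rs.1.length : ℕ∞)) ⟨[x, y], ?_, ?_⟩ le_rfl
    · simp [hx, hy]
    · exact (hcons x y []).mpr ⟨h, RingTheory.Sequence.IsWeaklyRegular.nil _ _⟩

/-- A linear form on a free module over a unique factorization domain has an ideal of values of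
grade at least two if and only if every form proportional to it is a multiple of it. -/
lemma two_le_seqGrade_range_iff [IsDomain A] [UniqueFactorizationMonoid A] [Module.Free A F]
    {D : Module.Dual A F} (hD : D ≠ 0) :
    2 ≤ Ideal.seqGrade (A := A) (LinearMap.range D) ↔
      ∀ ψ : Module.Dual A F, (∃ s t : A, s ≠ 0 ∧ s • ψ = t • D) → ∃ c : A, ψ = c • D := by
  classical
  rw [Ideal.two_le_seqGrade_iff]
  constructor
  · rintro ⟨_, ⟨v, rfl⟩, _, ⟨w, rfl⟩, hx, hy⟩ ψ ⟨s, t, hs, hst⟩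
    have hv : D v ≠ 0 := fun h => one_ne_zero (hx (by simp [h] : D v • (1 : A) = D v • 0))
    have h (u) : s * ψ u = t * D u := LinearMap.congr_fun hst u
    -- Proportionality gives `D w * ψ v = D v * ψ w`, so regularity of `D w` modulo `D v` forces `D
    -- v ∣ ψ v`. The quotient is the proportionality factor `t / s`.
    obtain ⟨q, hq⟩ := hy (ψ v) ⟨ψ w, mul_left_cancel₀ hs (by
      linear_combination D w * h v - D v * h w)⟩
    refine ⟨q, LinearMap.ext fun u => ?_⟩
    have hsq : t = s * q := mul_left_cancel₀ hv (by linear_combination s * hq - h v)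
    exact mul_left_cancel₀ hs (by
      rw [LinearMap.smul_apply, smul_eq_mul]; linear_combination h u + D u * hsq)
  · intro H
    obtain ⟨v, hv⟩ : ∃ v, D v ≠ 0 := by
      by_contra! h
      exact hD (LinearMap.ext h)
    refine ⟨D v, ⟨v, rfl⟩, ?_⟩
    -- If a prime `p` divided all values of `D`, then `D / p` would be a form proportional to `D`,
    -- hence equal to `k • D`, and `p * k = 1`.
    have hnot : ¬ ∃ p ∈ (UniqueFactorizationMonoid.factors (D v)).toFinset,
        (LinearMap.range D : Ideal A) ≤ Ideal.span {p} := by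
      rintro ⟨p, hp, hle⟩
      have hp := UniqueFactorizationMonoid.prime_of_factor p (Multiset.mem_toFinset.mp hp)
      let b := Module.Free.chooseBasis A F
      have hb (i) : ∃ c, D (b i) = p * c := Ideal.mem_span_singleton.mp (hle ⟨b i, rfl⟩)
      choose c hc using hb
      have hpD : p • b.constr A c = D := b.ext fun i => by simp [hc]
      obtain ⟨k, hk⟩ := H (b.constr A c) ⟨p, 1, hp.ne_zero, by rw [hpD, one_smul]⟩
      apply hp.not_isUnit
      refine IsUnit.of_mul_eq_one k (mul_right_cancel₀ hv ?_)
      have := LinearMap.congr_fun hpD v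
      rw [hk] at this
      simpa [mul_assoc] using this
    -- Prime avoidance over the finitely many prime factors of `D v` finds a value `y` of `D`
    -- coprime to `D v`.
    rw [← Ideal.subset_union_prime 0 0 fun p hp _ _ => ?_] at hnot
    · obtain ⟨y, hy, hyp⟩ := Set.not_subset.mp hnot
      refine ⟨y, hy, IsSMulRegular.of_ne_zero hv, fun q hq => ?_⟩
      refine IsRelPrime.dvd_of_dvd_mul_left ?_ hq
      refine UniqueFactorizationMonoid.isRelPrime_iff_no_prime_factors hv |>.mpr ?_
      intro d hdx hdy hd
      obtain ⟨p, hp, hdp⟩ := UniqueFactorizationMonoid.exists_mem_factors_of_dvd hv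
        hd.irreducible hdx
      exact hyp (Set.mem_biUnion (Multiset.mem_toFinset.mpr hp)
        (Ideal.mem_span_singleton.mpr (hdp.symm.dvd.trans hdy)))
    · have := UniqueFactorizationMonoid.prime_of_factor p (Multiset.mem_toFinset.mp hp)
      exact (Ideal.span_singleton_prime this.ne_zero).mpr this

/-- A linear form vanishing on a linearly independent family of maximal size is zero. -/
lemma LinearMap.eq_zero_of_linearIndependent_ker {f : ℕ} [IsDomain A] [Module.Finite A F]
    (hF : Module.finrank A F = f) {v : Fin f → F} (hv : LinearIndependent A v)
    {χ : Module.Dual A F} (h : ∀ i, χ (v i) = 0) : χ = 0 := by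
  ext u
  rw [LinearMap.zero_apply]
  by_contra hu
  have : LinearIndependent A (Fin.cons u v : Fin (f + 1) → F) := by
    rw [Fintype.linearIndependent_iff] at hv ⊢
    intro g hg
    rw [Fin.sum_univ_succ] at hg
    simp only [Fin.cons_zero, Fin.cons_succ] at hg
    have h0 : g 0 = 0 := by
      have := congrArg χ hg
      simpa [h, hu] using this
    rw [h0, zero_smul, zero_add] at hg
    intro i
    refine Fin.cases h0 (hv _ hg) i
  have := this.fintype_card_le_finrank
  simp [hF] at this

variable {G : Type*} [AddCommGroup G] [Module A G]

/-- Let `α : G → F` have corank one, and suppose that `⋀^r α` factors through `a : A → ⋀^r F` for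
`r = rank α`. Then `v ↦ η (v ∧ a)` lies in the kernel of `α^*`, and it generates this kernel if and
only if the coordinates of `a` generate an ideal of grade at least two. -/
theorem toDual_exact_iff [IsDomain A] [IsNoetherianRing A] [UniqueFactorizationMonoid A] [Module.Free A F]
    [Module.Finite A F] (α : G →ₗ[A] F) {r : ℕ} (hr : α.mapRank = r)
    (hF : Module.finrank A F = r + 1) (η : FreeOrientation A F) (a : ⋀[A]^r F)
    (ha : ∀ w : ⋀[A]^r G, ∃ c : A, exteriorPower.map r α w = c • a) :
    α.dualMap (η.toDual (a : ExteriorAlgebra A F)) = 0 ∧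
      ((∀ ψ, α.dualMap ψ = 0 → ∃ c : A, ψ = c • η.toDual (a : ExteriorAlgebra A F)) ↔
        2 ≤ (LinearMap.toSpanSingleton A _ a).rankIdeal.seqGrade) := by
  obtain ⟨v, hv⟩ := exists_linearIndependent_of_le_finrank (R := A) (M := LinearMap.range α) hr.ge
  choose w hw using fun i => (v i).2
  have hαw : LinearIndependent A (α ∘ w) := by
    have : α ∘ w = (LinearMap.range α).subtype ∘ v := funext hw
    rw [this]
    exact hv.map' _ (Submodule.ker_subtype _)
  -- The corank is one, so a single vector `u` completes the `α (w i)` to a maximal independent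
  -- family.
  obtain ⟨u, hu⟩ := exists_linearIndependent_cons_of_lt_finrank hαw (by omega)
  have b : Module.Basis (Fin (r + 1)) A F := Module.finBasisOfFinrankEq A F hF
  obtain ⟨c, hc⟩ := ha (exteriorPower.ιMulti A r w)
  rw [exteriorPower.map_apply_ιMulti] at hc
  have hcD (x) : c * η.toDual (a : ExteriorAlgebra A F) x =
      η.alternating (r + 1) (Fin.cons x (α ∘ w)) := by
    rw [← toDual_ιMulti, ← exteriorPower.ιMulti_apply_coe, hc]
    simp
  have hDu : c * η.toDual (a : ExteriorAlgebra A F) u ≠ 0 := by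
    rw [hcD]; exact η.alternating_ne_zero hF b hu
  obtain ⟨hc0, hDu⟩ := mul_ne_zero_iff.mp hDu
  have hDα (g) : η.toDual (a : ExteriorAlgebra A F) (α g) = 0 := by
    refine (mul_eq_zero.mp ((hcD _).trans ?_)).resolve_left hc0
    -- The vectors `α g, α (w i)` are `r + 1` elements of a module of rank `r`.
    refine AlternatingMap.map_linearDependent _ _ fun hli => ?_
    have : LinearIndependent A (fun i : Fin (r + 1) =>
        (⟨α ((Fin.cons g w : Fin (r + 1) → G) i), ⟨_, rfl⟩⟩ : LinearMap.range α)) := by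
      refine LinearIndependent.of_comp (LinearMap.range α).subtype ?_
      refine Eq.subst (motive := fun x => LinearIndependent A x) (funext fun i => ?_) hli
      refine Fin.cases ?_ (fun i => ?_) i <;> simp
    have := this.fintype_card_le_finrank
    rw [Fintype.card_fin] at this
    change r + 1 ≤ α.mapRank at this
    omega
  have hD : η.toDual (a : ExteriorAlgebra A F) ≠ 0 := fun h => hDu (by simp [h])
  have ha0 : a ≠ 0 := fun h => hD (by simp [h])
  have hI : (LinearMap.toSpanSingleton A _ a).rankIdeal =
      LinearMap.range (η.toDual (a : ExteriorAlgebra A F)) := by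
    rw [LinearMap.rankIdeal, mapRank_toSpanSingleton ha0, minorsIdeal_one_toSpanSingleton]
    apply le_antisymm
    · rw [Ideal.span_le]
      rintro _ ⟨ψ, rfl⟩
      obtain ⟨x, hx⟩ := η.exists_toDual_apply_eq hF ψ
      exact ⟨x, hx a⟩
    · rintro _ ⟨x, rfl⟩
      exact Ideal.subset_span ⟨η.toDual.flip x ∘ₗ Submodule.subtype _, rfl⟩
  refine ⟨LinearMap.ext hDα, ?_⟩
  rw [hI, two_le_seqGrade_range_iff hD]
  refine forall_congr' fun ψ => imp_congr_left ⟨fun h => ?_, ?_⟩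
  · refine ⟨_, ψ u, hDu, ?_⟩
    rw [← sub_eq_zero]
    refine LinearMap.eq_zero_of_linearIndependent_ker hF hu fun i => ?_
    refine Fin.cases ?_ (fun i => ?_) i
    · simp [mul_comm]
    · have : ψ (α (w i)) = 0 := LinearMap.congr_fun h _
      simp [this, hDα]
  · rintro ⟨s, t, hs, h⟩
    ext g
    have := LinearMap.congr_fun h (α g)
    simpa [hDα, hs] using this

end

namespace CodimTwoSetup

variable {𝕜 : Type u} [Field 𝕜] {n : ℕ} (D : CodimTwoSetup 𝕜 n)

/-! ### The presentation of `Sym(I)` as `B / (l_1, …, l_n)`. -/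

section Presentation

@[simp]
lemma symMap_C_X (i : Fin (n + 1)) : D.symMap (C (X i)) = D.symGen i := by
  rw [← algebraMap_eq, AlgHom.commutes]
  change eval₂Hom _ _ (X i) = _
  simp

@[simp]
lemma symMap_map_C (p : MvPolynomial (Fin n) 𝕜) :
    D.symMap (map C p) = algebraMap (MvPolynomial (Fin n) 𝕜) D.Sym p := by
  induction p using MvPolynomial.induction_on with
  | C c =>
    rw [map_C, ← algebraMap_eq, AlgHom.commutes]
    change eval₂Hom _ _ (C c) = _
    simp
  | add p q hp hq => simp only [map_add, hp, hq]
  | mul_X p i hp => rw [map_mul, map_mul, map_mul, hp, map_X, symMap, aeval_X]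

lemma symMap_l (j : Fin n) : D.symMap (D.l j) = 0 := by
  have h : ∑ i, D.φ i j • D.f i = 0 := by
    have := D.presentation.apply_apply_eq_zero (Pi.single j 1)
    simpa [Fintype.linearCombination_apply] using this
  simp only [l, map_sum, map_mul, symMap_C_X, symMap_map_C]
  have h' : ∑ i, D.φ i j • (⟨D.f i, Ideal.subset_span (Set.mem_range_self i)⟩ : D.I) = 0 :=
    Subtype.ext (by simpa using h)
  have h2 := congrArg (SymmetricAlgebra.ι (MvPolynomial (Fin n) 𝕜) D.I) h'
  rw [map_sum, map_zero] at h2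
  refine Eq.trans (Finset.sum_congr rfl fun i _ => ?_) h2
  rw [map_smul, Algebra.smul_def, mul_comm]
  rfl

/-- A ring homomorphism on `B` that kills `l_1, …, l_n` factors through `Sym(I)`. -/
lemma exists_comp_symMap_eq {Q : Type*} [CommRing Q] (q : B 𝕜 n →+* Q)
    (hq : ∀ j, q (D.l j) = 0) : ∃ ρ : D.Sym →+* Q, ∀ p, ρ (D.symMap p) = q p := by
  let : Algebra (MvPolynomial (Fin n) 𝕜) Q := (q.comp (map C)).toAlgebra
  have hsmul (c : MvPolynomial (Fin n) 𝕜) (x : Q) : c • x = q (map C c) * x := rfl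
  let g : (Fin (n + 1) → MvPolynomial (Fin n) 𝕜) →ₗ[MvPolynomial (Fin n) 𝕜] Q :=
    Fintype.linearCombination (MvPolynomial (Fin n) 𝕜)
      fun i => q (C (X i))
  let π : (Fin (n + 1) → MvPolynomial (Fin n) 𝕜) →ₗ[MvPolynomial (Fin n) 𝕜] D.I :=
    Fintype.linearCombination (MvPolynomial (Fin n) 𝕜)
      fun i => (⟨D.f i, Ideal.subset_span (Set.mem_range_self i)⟩ : D.I)
  have hπ : Function.Surjective π := by
    rintro ⟨x, hx⟩
    obtain ⟨c, hc⟩ := Ideal.mem_span_range_iff_exists_fun.mp hx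
    exact ⟨c, Subtype.ext (by simpa [π, Fintype.linearCombination_apply] using hc)⟩
  -- The syzygies of the `f i` are spanned by the columns of `φ`, and `g` sends the `j`-th column to
  -- `q (D.l j) = 0`.
  have hker : LinearMap.ker π ≤ LinearMap.ker g := by
    intro c hc
    have hc' : Fintype.linearCombination (MvPolynomial (Fin n) 𝕜) D.f c = 0 := by
      have := congrArg Subtype.val (LinearMap.mem_ker.mp hc)
      simpa [π, Fintype.linearCombination_apply] using this
    obtain ⟨b, rfl⟩ := (D.presentation c).mp hc'
    rw [LinearMap.mem_ker, Matrix.mulVecLin_apply]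
    have hcol (j : Fin n) : g (D.φ.col j) = 0 := by
      rw [← hq j]
      simp only [g, Fintype.linearCombination_apply, hsmul, l, map_sum, map_mul, Matrix.col_apply]
      exact Finset.sum_congr rfl fun i _ => mul_comm _ _
    have : D.φ.mulVec b = ∑ j, b j • D.φ.col j := by
      ext1 i
      simp [Matrix.mulVec, dotProduct, mul_comm]
    rw [this, map_sum]
    exact Finset.sum_eq_zero fun j _ => by rw [map_smul, hcol, smul_zero]
  let h : D.I →ₗ[MvPolynomial (Fin n) 𝕜] Q :=
    (LinearMap.ker π).liftQ g hker ∘ₗ (π.quotKerEquivOfSurjective hπ).symm.toLinearMap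
  have hh (c) : h (π c) = g c := by
    have : (π.quotKerEquivOfSurjective hπ).symm (π c) = Submodule.Quotient.mk c := by
      rw [LinearEquiv.symm_apply_eq]; rfl
    simp [h, this]
  let ρ : D.Sym →ₐ[MvPolynomial (Fin n) 𝕜] Q := SymmetricAlgebra.lift h
  have hρ (i) : ρ (D.symGen i) = q (C (X i)) := by
    refine (SymmetricAlgebra.lift_ι_apply h _).trans ?_
    have := hh (Pi.single i 1)
    simpa [π, g] using this
  refine ⟨ρ.toRingHom, fun p => ?_⟩
  suffices ρ.toRingHom.comp D.symMap.toRingHom = q from RingHom.congr_fun this p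
  apply MvPolynomial.ringHom_ext
  · intro s
    suffices (ρ.toRingHom.comp D.symMap.toRingHom).comp C =
      q.comp C from RingHom.congr_fun this s
    apply MvPolynomial.ringHom_ext
    · intro c
      have := D.symMap_map_C (C c)
      rw [map_C] at this
      simp only [RingHom.comp_apply, AlgHom.toRingHom_eq_coe, RingHom.coe_coe, this,
        AlgHom.commutes]
      change q (map C (C c)) = _
      rw [map_C]
    · intro i
      have := D.symMap_C_X i
      simp only [RingHom.comp_apply, AlgHom.toRingHom_eq_coe, RingHom.coe_coe, this, hρ]
  · intro i
    have := D.symMap_map_C (X i)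
    rw [map_X] at this
    simp only [RingHom.comp_apply, AlgHom.toRingHom_eq_coe, RingHom.coe_coe, this,
      AlgHom.commutes]
    change q (map C (X i)) = _
    rw [map_X]

lemma symMap_eq_zero_iff (p : B 𝕜 n) : D.symMap p = 0 ↔ p ∈ Ideal.span (Set.range D.l) := by
  constructor
  · intro h
    have hl (j) : Ideal.Quotient.mk (Ideal.span (Set.range D.l)) (D.l j) = 0 :=
      Ideal.Quotient.eq_zero_iff_mem.mpr (Ideal.subset_span (Set.mem_range_self j))
    obtain ⟨ρ, hρ⟩ := D.exists_comp_symMap_eq (Q := B 𝕜 n ⧸ Ideal.span (Set.range D.l))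
      (Ideal.Quotient.mk _) hl
    rw [← Ideal.Quotient.eq_zero_iff_mem, ← hρ, h, map_zero]
  · intro h
    have : Ideal.span (Set.range D.l) ≤ RingHom.ker D.symMap := by
      rw [Ideal.span_le]
      rintro _ ⟨j, rfl⟩
      exact D.symMap_l j
    exact this h

end Presentation

/-! ### Graded strands and the rank of `F_0`. -/

section Pieces

lemma piece_eq_restrictSupport (e : ℤ) : piece 𝕜 n e = restrictSupport (S 𝕜 n)
    {m : Fin n →₀ ℕ | Finsupp.weight (fun _ : Fin n => (1 : ℤ)) m = e} :=
  weightedHomogeneousSubmodule_eq_finsupp_supported _ _ _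

instance (e : ℤ) : Module.Free (S 𝕜 n) (piece 𝕜 n e) := by
  rw [piece_eq_restrictSupport]
  exact Module.Free.of_basis (basisRestrictSupport (S 𝕜 n) _)

lemma finite_setOf_weight_eq (n : ℕ) (e : ℤ) :
    {m : Fin n →₀ ℕ | Finsupp.weight (fun _ : Fin n => (1 : ℤ)) m = e}.Finite := by
  refine (Finsupp.finite_of_degree_le e.toNat).subset fun m hm => ?_
  have : (m.degree : ℤ) = e := by
    rw [← (show Finsupp.weight (fun _ : Fin n => (1 : ℤ)) m = e from hm)]
    simp [Finsupp.weight_apply, Finsupp.sum, Finsupp.degree_apply]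
  change m.degree ≤ _
  omega

instance (e : ℤ) : Module.Finite (S 𝕜 n) (piece 𝕜 n e) := by
  have := (finite_setOf_weight_eq n e).to_subtype
  rw [piece_eq_restrictSupport]
  exact Module.Finite.of_basis (basisRestrictSupport (S 𝕜 n) _)

instance (e : ℤ) (t : ℕ) : Module.Free (S 𝕜 n) (D.F e t) :=
  inferInstanceAs (Module.Free (S 𝕜 n) ((J : {J : Finset (Fin n) // J.card = t}) →
    piece 𝕜 n (e - ∑ j ∈ J.1, (D.d j : ℤ))))

instance (e : ℤ) (t : ℕ) : Module.Finite (S 𝕜 n) (D.F e t) :=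
  inferInstanceAs (Module.Finite (S 𝕜 n) ((J : {J : Finset (Fin n) // J.card = t}) →
    piece 𝕜 n (e - ∑ j ∈ J.1, (D.d j : ℤ))))

lemma weightedHomogeneousComponent_l_mul (j : Fin n) (e : ℤ) (p : B 𝕜 n) :
    weightedHomogeneousComponent (fun _ : Fin n => (1 : ℤ)) e (D.l j * p) =
      D.l j * weightedHomogeneousComponent (fun _ : Fin n => (1 : ℤ)) (e - D.d j) p := by
  let := weightedGradedAlgebra (S 𝕜 n) (fun _ : Fin n => (1 : ℤ))
  have := DirectSum.coe_decompose_mul_add_of_left_mem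
    (weightedHomogeneousSubmodule (S 𝕜 n) (fun _ : Fin n => (1 : ℤ))) (j := e - D.d j) (b := p)
    (D.l_mem j)
  rw [add_sub_cancel] at this
  rw [← weightedDecomposition.decompose'_apply, ← weightedDecomposition.decompose'_apply]
  exact this

/-- `F_0 → Sym(I)_e` -/
def augmentation (e : ℤ) : D.F e 0 →ₗ[S 𝕜 n] D.Sym :=
  D.symMap.toLinearMap ∘ₗ Submodule.subtype _ ∘ₗ D.proj e 0 ⟨∅, Finset.card_empty⟩

lemma range_augmentation (e : ℤ) : LinearMap.range (D.augmentation e) = D.symPiece e := by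
  have he : e - ∑ j ∈ (∅ : Finset (Fin n)), (D.d j : ℤ) = e := by simp
  rw [augmentation, LinearMap.range_comp, symPiece]
  congr 1
  have hp : Function.Surjective (D.proj e 0 ⟨∅, Finset.card_empty⟩) := fun x =>
    ⟨fun J => ⟨x.1, by
      obtain ⟨J, hJ⟩ := J
      obtain rfl := Finset.card_eq_zero.mp hJ
      exact x.2⟩, rfl⟩
  rw [LinearMap.range_comp, LinearMap.range_eq_top.mpr hp, Submodule.map_subtype_top, he]

lemma α_zero_apply (e : ℤ) (g : D.F e 1) :
    (D.proj e 0 ⟨∅, Finset.card_empty⟩ (D.α e 0 g) : B 𝕜 n) =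
      ∑ j, D.l j * (D.proj e 1 ⟨{j}, Finset.card_singleton j⟩ g : B 𝕜 n) := by
  change ((D.αComponent e 0 ⟨∅, Finset.card_empty⟩ g : piece 𝕜 n _) : B 𝕜 n) = _
  rw [αComponent, LinearMap.sum_apply, AddSubmonoidClass.coe_finsetSum]
  refine Fintype.sum_equiv (Equiv.subtypeUnivEquiv fun j => Finset.notMem_empty j) _ _ fun j => ?_
  simp only [Finset.filter_empty, Finset.card_empty, pow_zero, one_smul, LinearMap.comp_apply]
  rfl

/-- In a relation `x = ∑ c_j l_j` with `x` of degree `e`, each `c_j` may be replaced by its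
component of degree `e - d_j`, because the `l_j` are homogeneous. -/
lemma ker_augmentation (e : ℤ) : LinearMap.ker (D.augmentation e) = LinearMap.range (D.α e 0) := by
  have hinj : Function.Injective (D.proj e 0 ⟨∅, Finset.card_empty⟩) := fun x y h => funext fun ⟨J, hJ⟩ => by
    obtain rfl := Finset.card_eq_zero.mp hJ
    exact h
  ext x
  rw [LinearMap.mem_ker]
  change D.symMap (D.proj e 0 ⟨∅, Finset.card_empty⟩ x : B 𝕜 n) = 0 ↔ _
  rw [symMap_eq_zero_iff, Ideal.mem_span_range_iff_exists_fun]
  constructor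
  · rintro ⟨c, hc⟩
    let w : Fin n → ℤ := fun _ => 1
    obtain ⟨g, hg⟩ : ∃ g : D.F e 1, ∀ j,
        (D.proj e 1 ⟨{j}, Finset.card_singleton j⟩ g : B 𝕜 n) =
          weightedHomogeneousComponent w (e - D.d j) (c j) :=
      -- Here `J` is a singleton; summing over it avoids choosing its element and transporting along
      -- the degree.
      ⟨fun J => ⟨weightedHomogeneousComponent w (e - ∑ j ∈ J.1, (D.d j : ℤ)) (∑ j ∈ J.1, c j),
        weightedHomogeneousComponent_mem _ _ _⟩, fun j => by
          change weightedHomogeneousComponent w (e - ∑ i ∈ {j}, (D.d i : ℤ)) (∑ i ∈ {j}, c i) = _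
          rw [Finset.sum_singleton, Finset.sum_singleton]⟩
    refine ⟨g, hinj (Subtype.ext ?_)⟩
    have hx : weightedHomogeneousComponent w e
        (D.proj e 0 ⟨∅, Finset.card_empty⟩ x : B 𝕜 n) =
          (D.proj e 0 ⟨∅, Finset.card_empty⟩ x : B 𝕜 n) := by
      have h : _ ∈ weightedHomogeneousSubmodule (S 𝕜 n) w _ :=
        (D.proj e 0 ⟨∅, Finset.card_empty⟩ x).2
      rw [weightedHomogeneousComponent_of_mem h, if_pos (by simp)]
    rw [α_zero_apply, ← hx, ← hc, map_sum]
    refine Finset.sum_congr rfl fun j _ => ?_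
    rw [mul_comm (c j), weightedHomogeneousComponent_l_mul, hg]
  · rintro ⟨g, rfl⟩
    rw [α_zero_apply]
    exact ⟨_, Finset.sum_congr rfl fun j _ => mul_comm _ _⟩

lemma finrank_F_zero (e : ℤ) : Module.finrank (S 𝕜 n) (D.F e 0) =
    Module.finrank (S 𝕜 n) (D.symPiece e) + D.r e 0 := by
  rw [← (D.augmentation e).quotKerEquivRange.finrank_eq.trans
    (by rw [range_augmentation] : _ = Module.finrank (S 𝕜 n) (D.symPiece e)), r,
    LinearMap.mapRank, ← ker_augmentation, Submodule.finrank_quotient_add_finrank]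

end Pieces

/-! ### Specialization to the Koszul strand. -/

lemma two_le (D : CodimTwoSetup 𝕜 n) : 2 ≤ n := by
  have hI : Ideal.span (Set.range D.f) ≠ ⊤ := fun h => by
    have := D.codim_two
    rw [h, Ideal.height_top] at this
    exact absurd this (by decide)
  have := Ideal.height_le_ringKrullDim_of_ne_top hI
  rw [D.codim_two, ringKrullDim_of_isNoetherianRing, ringKrullDim_eq_zero_of_field, zero_add,
    Nat.card_fin] at this
  exact_mod_cast this

lemma exists_dualMap_iff (e : ℤ) (hr : Module.finrank (S 𝕜 n) (D.F e 0) = D.r e 0 + 1)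
    (η : FreeOrientation (S 𝕜 n) (D.F e 0)) (a : ⋀[S 𝕜 n]^(D.r e 0) (D.F e 0))
    (ψ : Module.Dual (S 𝕜 n) (D.F e 0)) :
    (∃ u, D.dualMap e η a u = ψ) ↔
      ∃ c : S 𝕜 n, ψ = c • η.toDual (a : ExteriorAlgebra (S 𝕜 n) (D.F e 0)) := by
  -- The source of `dualMap` is therefore `⋀^0 F_0`, the scalars inside the exterior algebra.
  have h0 : Module.finrank (S 𝕜 n) (D.F e 0) - D.r e 0 - 1 = 0 := by omega
  have hmem (x : ExteriorAlgebra (S 𝕜 n) (D.F e 0)) :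
      x ∈ ⋀[S 𝕜 n]^(Module.finrank (S 𝕜 n) (D.F e 0) - D.r e 0 - 1) (D.F e 0) ↔
        ∃ c, algebraMap (S 𝕜 n) _ c = x := by
    rw [h0, ExteriorAlgebra.exteriorPower, pow_zero, Submodule.mem_one]
  constructor
  · rintro ⟨⟨x, hx⟩, rfl⟩
    obtain ⟨c, rfl⟩ := (hmem x).mp hx
    exact ⟨c, by simp [dualMap, ← Algebra.smul_def]⟩
  · rintro ⟨c, rfl⟩
    exact ⟨⟨algebraMap _ _ c, (hmem _).mpr ⟨c, rfl⟩⟩, by simp [dualMap, ← Algebra.smul_def]⟩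

end CodimTwoSetup

end

theorem theorem4 {𝕜 : Type u} [Field 𝕜] {n : ℕ} (D : CodimTwoSetup 𝕜 n) (i : ℤ)
    (hrank : Module.finrank (CodimTwoSetup.S 𝕜 n) (D.symPiece (D.δ - i)) = 1)
    (η : ∀ t, FreeOrientation (CodimTwoSetup.S 𝕜 n) (D.F (D.δ - i) t))
    (a : ∀ t, ⋀[CodimTwoSetup.S 𝕜 n]^(D.r (D.δ - i) t) (D.F (D.δ - i) t))
    (ha : D.IsMultipliers (D.δ - i) η a) :
    (D.α (D.δ - i) 0).dualMap ∘ₗ D.dualMap (D.δ - i) (η 0) (a 0) = 0 ∧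
    (Function.Exact (D.dualMap (D.δ - i) (η 0) (a 0)) (D.α (D.δ - i) 0).dualMap ↔
      2 ≤ (LinearMap.toSpanSingleton (CodimTwoSetup.S 𝕜 n) _ (a 0)).rankIdeal.seqGrade) := by
  have hF : Module.finrank (CodimTwoSetup.S 𝕜 n) (D.F (D.δ - i) 0) = D.r (D.δ - i) 0 + 1 := by
    rw [D.finrank_F_zero, hrank, add_comm]
  have hd := D.exists_dualMap_iff (D.δ - i) hF (η 0) (a 0)
  -- Since `n ≥ 2`, the multiplier `a 0` is governed by `factor` and not by `last`.
  obtain ⟨h0, hiff⟩ := toDual_exact_iff (D.α (D.δ - i) 0) rfl hF (η 0) (a 0)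
    fun w => ⟨_, ha.factor 0 D.two_le w⟩
  have hcomp (u) : (D.α (D.δ - i) 0).dualMap (D.dualMap (D.δ - i) (η 0) (a 0) u) = 0 := by
    obtain ⟨c, hc⟩ := (hd _).mp ⟨u, rfl⟩
    rw [hc, map_smul, h0, smul_zero]
  refine ⟨LinearMap.ext hcomp, Iff.trans ?_ hiff⟩
  refine forall_congr' fun ψ => ⟨fun h hψ => (hd ψ).mp (h.mp hψ), fun h =>
    ⟨fun hψ => (hd ψ).mpr (h hψ), ?_⟩⟩
  rintro ⟨u, rfl⟩
  exact hcomp u
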